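/- Let $I=[0,1]$. For a continuous map $f:I\to I$ and $z\in I$, a backward orbit branch of $z$ is a sequence $(z_i)_{i\ge 0}$ with $z_0=z$ and $f(z_{i+1})=z_i$ for all $i$; the special $\alpha$-limit set $s\alpha(z)$ is the set of all limits of convergent subsequences of backward orbit branches of $z$. For $A\subseteq I$ put $\mathrm{Orb}(A)=\bigcup_{n\ge0}f^n(A)$. If $L$ is a non-degenerate closed interval such that $L,f(L),\dots,f^{k-1}(L)$ are pairwise disjoint and $f^k(L)=L$, then $\mathrm{Orb}(L)$ is called a cycle of intervals of period $k$. Call a continuous map $f:I\to I$ a Chu–Xiong map if there are closed intervals $J_n,A_n,B_n,K_{n+1},C_n\subseteq I$ ($n\ge 0$) such that: 1. $M_n=\mathrm{Orb}(J_n)$ is a cycle of intervals of period $2^n$ (with $L=J_n$), and $I=J_0=M_0\supseteq M_1\supseteq M_2\supseteq\cdots$. 2. $J_n$ is the leftmost connected component of $M_n$. 3. $J_n=A_n\cup J_{n+1}\cup B_n\cup K_{n+1}\cup C_n$ is a union of five non-degenerate closed intervals with disjoint interiors, listed from left to right. 4. $f^{2^n}$ maps $A_n$ onto $A_n\cup J_{n+1}\cup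 B_n$, $K_{n+1}$ onto $J_{n+1}$, and $C_n$ onto $B_n\cup K_{n+1}\cup C_n$ by increasing linear (i.e. affine) bijections; it maps $B_n$ onto $J_{n+1}\cup B_n\cup K_{n+1}$ by a decreasing linear bijection; and it maps $J_{n+1}$ onto $K_{n+1}$. 5. $J_\infty=\bigcap_{n\ge0}J_n$ is a non-degenerate interval $[x,y]$. Theorem. (i) There exists a Chu–Xiong map with zero topological entropy. (ii) For every Chu–Xiong map $f$ (and every choice of the intervals above), the left endpoint $x$ of $J_\infty$ satisfies $x\in\overline{s\alpha(x)}\setminus s\alpha(x)$; in particular $s\alpha(x)$ is not closed. (iii) Consequently, the conjecture of Kolyada, Misiurewicz and Snoha that all special $\alpha$-limit sets of all continuous maps $I\to I$ are closed is false. -/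

import Mathlib

open Set Filter Topology

/-- A backward orbit branch of `x`: a sequence `b` with `b 0 = x` and `f (b (n + 1)) = b n`. -/
def IsBackwardBranch {X : Type*} (f : X → X) (x : X) (b : ℕ → X) : Prop :=
  b 0 = x ∧ ∀ n, f (b (n + 1)) = b n

/-- The special `α`-limit set of `x`: all limits of subsequences of backward orbit branches
of `x`. -/
def specialAlphaLimit {X : Type*} [TopologicalSpace X] (f : X → X) (x : X) : Set X :=
  {y | ∃ b : ℕ → X, IsBackwardBranch f x b ∧
    ∃ φ : ℕ → ℕ, StrictMono φ ∧ Tendsto (fun i => b (φ i)) atTop (𝓝 y)}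

/-- The forward orbit of a set: the union of `f^n(A)` over `n ≥ 0`. -/
def setOrbit {X : Type*} (f : X → X) (A : Set X) : Set X := ⋃ n : ℕ, f^[n] '' A

/-- `K` is a non-degenerate closed interval such that `K, f(K), …, f^(k-1)(K)` are pairwise
disjoint and `f^k(K) = K`; then `setOrbit f K` is a cycle of intervals of period `k`. -/
def IsPeriodicInterval (f : unitInterval → unitInterval) (K : Set unitInterval) (k : ℕ) : Prop :=
  0 < k ∧ (∃ u v : unitInterval, u < v ∧ K = Icc u v) ∧
    (∀ i < k, ∀ j < k, i ≠ j → Disjoint (f^[i] '' K) (f^[j] '' K)) ∧ f^[k] '' K = K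

/-- `C` is a connected component of `S` and lies to the left of the rest of `S`. -/
def IsLeftmostComponent (S C : Set unitInterval) : Prop :=
  (∃ t ∈ S, C = connectedComponentIn S t) ∧ ∀ u ∈ C, ∀ v ∈ S \ C, u < v

/-- `g` restricts to an increasing linear (affine) bijection from `S` onto `T`. -/
def IsIncreasingLinearBij (g : unitInterval → unitInterval) (S T : Set unitInterval) : Prop :=
  BijOn g S T ∧ ∃ m k : ℝ, 0 < m ∧ ∀ t ∈ S, (g t : ℝ) = m * (t : ℝ) + k

/-- `g` restricts to a decreasing linear (affine) bijection from `S` onto `T`. -/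
def IsDecreasingLinearBij (g : unitInterval → unitInterval) (S T : Set unitInterval) : Prop :=
  BijOn g S T ∧ ∃ m k : ℝ, m < 0 ∧ ∀ t ∈ S, (g t : ℝ) = m * (t : ℝ) + k

/-- Endpoints of the intervals of the construction: `J n = [a n, b n]`, which is cut by the points
`a (n + 1) < b (n + 1) < c n < d n` into five non-degenerate closed intervals, from left to right
`A n`, `J (n + 1)`, `B n`, `K (n + 1)`, `C n`; moreover `J 0 = [0, 1]`, and the intersection of all
`J n` is the non-degenerate interval `[x, y]`. -/
structure ChuXiongIntervals where
  (a b c d : ℕ → unitInterval)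
  (x y : unitInterval)
  a_zero : a 0 = 0
  b_zero : b 0 = 1
  a_lt : ∀ n, a n < a (n + 1)
  a_lt_b : ∀ n, a (n + 1) < b (n + 1)
  b_lt_c : ∀ n, b (n + 1) < c n
  c_lt_d : ∀ n, c n < d n
  d_lt_b : ∀ n, d n < b n
  x_lt_y : x < y
  iInter_eq : ⋂ n, Icc (a n) (b n) = Icc x y

namespace ChuXiongIntervals

variable (S : ChuXiongIntervals) (n : ℕ)

/-- The interval `J n`. -/
def J : Set unitInterval := Icc (S.a n) (S.b n)

/-- The interval `A n`. -/
def A : Set unitInterval := Icc (S.a n) (S.a (n + 1))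

/-- The interval `B n`. -/
def B : Set unitInterval := Icc (S.b (n + 1)) (S.c n)

/-- `S.Ksucc n` is the interval `K (n + 1)` inside `J n` (there is no `K 0`). -/
def Ksucc : Set unitInterval := Icc (S.c n) (S.d n)

/-- The interval `C n`. -/
def C : Set unitInterval := Icc (S.d n) (S.b n)

end ChuXiongIntervals

/-- `f` is a Chu–Xiong map for the intervals `S`: with `M n` the forward orbit of `J n`,
the sets `[0, 1] = M 0 ⊇ M 1 ⊇ …` are cycles of intervals of periods `2 ^ n`, the leftmost
component of `M n` is `J n`, and `f ^ (2 ^ n)` acts on `J n` in the prescribed way. -/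
structure IsChuXiongMap (S : ChuXiongIntervals) (f : unitInterval → unitInterval) : Prop where
  continuous : Continuous f
  orbit_zero : setOrbit f (S.J 0) = univ
  orbit_succ_subset : ∀ n, setOrbit f (S.J (n + 1)) ⊆ setOrbit f (S.J n)
  periodic : ∀ n, IsPeriodicInterval f (S.J n) (2 ^ n)
  leftmost : ∀ n, IsLeftmostComponent (setOrbit f (S.J n)) (S.J n)
  on_A : ∀ n, IsIncreasingLinearBij f^[2 ^ n] (S.A n) (S.A n ∪ S.J (n + 1) ∪ S.B n)
  on_J : ∀ n, f^[2 ^ n] '' S.J (n + 1) = S.Ksucc n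
  on_B : ∀ n, IsDecreasingLinearBij f^[2 ^ n] (S.B n) (S.Ksucc n ∪ S.B n ∪ S.J (n + 1))
  on_K : ∀ n, IsIncreasingLinearBij f^[2 ^ n] (S.Ksucc n) (S.J (n + 1))
  on_C : ∀ n, IsIncreasingLinearBij f^[2 ^ n] (S.C n) (S.B n ∪ S.Ksucc n ∪ S.C n)

/-! ### Backward branches, orbits of sets and expanding affine pieces. -/

open scoped NNReal ENNReal

/-! Non-closedness. On `A n` the iterate `f^[2 ^ n]` expands away from its fixed point `a n`, and
the image of `A n` contains `x`. Pulling `x` back along this affine branch converges to `a n`, so `a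
n` lies in the special α-limit set of `x`, and `a n` tends to `x`. Conversely, a backward branch of
`x` accumulating at `x` visits every `J n` infinitely often, since `x` is interior to it; hence the
whole branch lies in every `M n`. Its `i`-th point, `i > 0`, cannot be in `J i`, because return
times to `J i` are multiples of `2 ^ i > i`. It therefore lies to the right of `J i`, hence of `y`,
and the branch cannot accumulate at `x < y` (`x_notMem_specialAlphaLimit`).

Existence. The example is a series of piecewise affine corrections to the identity. Its tails,
renormalised, are maps `returnMap m` of `J m` with `returnMap m ∘ returnMap m = returnMap (m + 1)`
on `J (m + 1)`, so `returnMap m` is the `2 ^ m`-th iterate of `returnMap 0` on `J m`.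

Zero entropy. The exponential growth rate of the variation of iterates bounds the entropy
(`coverEntropy_le_log_of_expBounded`). Outside `J (m + 1)` each monotone piece covers itself at most
once, so a rate `r ^ 2` at level `m + 1` gives rate `r` at level `m`
(`expBounded_eVariationOn_of_succ`). At level `k` the Lipschitz constant `101 * 2 ^ k` is a trivial
rate, and its `2 ^ k`-th root tends to `1`. -/

theorem IsBackwardBranch.iterate {X : Type*} {f : X → X} {x : X} {b : ℕ → X}
    (hb : IsBackwardBranch f x b) (m n : ℕ) : f^[m] (b (m + n)) = b n := by
  induction m with
  | zero => simp
  | succ m ih => rw [Function.iterate_succ_apply, Nat.add_right_comm, hb.2, ih]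

/-- A backward orbit branch of an iterate extends to a backward orbit branch of the map. -/
theorem IsBackwardBranch.of_iterate {X : Type*} {f : X → X} {x : X} {k : ℕ} {c : ℕ → X}
    (hk : 0 < k) (hc : IsBackwardBranch f^[k] x c) :
    IsBackwardBranch f x (fun m => f^[(k - 1) * m] (c m)) ∧
      ∀ i, f^[(k - 1) * (k * i)] (c (k * i)) = c i := by
  obtain ⟨l, rfl⟩ : ∃ l, k = l + 1 := ⟨k - 1, by omega⟩
  -- The point `c m` is `k * m` steps of `f` behind `x`; applying `f` another `(k - 1) * m` times
  -- leaves a point `m` steps behind.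
  refine ⟨⟨by simpa using hc.1, fun n => ?_⟩, fun i => ?_⟩
  · rw [← Function.iterate_succ_apply' f]
    have : (l + 1 - 1) * (n + 1) + 1 = l * n + (l + 1) := by simp; ring
    rw [Nat.succ_eq_add_one, this, Function.iterate_add_apply, hc.2]
    simp
  · have h1 : (l + 1 - 1) * ((l + 1) * i) = (l + 1) * (l * i) := by simp; ring
    have h2 : (l + 1) * i = l * i + i := by ring
    rw [h1, h2, Function.iterate_mul]
    exact hc.iterate (l * i) i

theorem setOrbit_mono {X : Type*} {f : X → X} {A B : Set X} (h : A ⊆ B) :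
    setOrbit f A ⊆ setOrbit f B :=
  iUnion_mono fun _ => image_mono h

theorem subset_setOrbit {X : Type*} (f : X → X) (A : Set X) : A ⊆ setOrbit f A := fun t ht =>
  mem_iUnion.2 ⟨0, t, ht, rfl⟩

theorem iterate_mem_setOrbit {X : Type*} {f : X → X} {A : Set X} {t : X}
    (ht : t ∈ setOrbit f A) (n : ℕ) : f^[n] t ∈ setOrbit f A := by
  obtain ⟨m, s, hs, rfl⟩ := mem_iUnion.1 ht
  exact mem_iUnion.2 ⟨n + m, s, hs, by rw [Function.iterate_add_apply]⟩

theorem image_iterate_mod {X : Type*} {f : X → X} {K : Set X} {k : ℕ} (h : f^[k] '' K = K)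
    (i : ℕ) : f^[i] '' K = f^[i % k] '' K := by
  have key : ∀ j, f^[k * j] '' K = K := by
    intro j
    induction j with
    | zero => simp
    | succ j ih => rw [Nat.mul_succ, Function.iterate_add, image_comp, h, ih]
  conv_lhs => rw [← Nat.mod_add_div i k, Function.iterate_add, image_comp, key]

/-- An increasing affine bijection of a segment onto a longer one with the same left endpoint
dilates distances to this endpoint. -/
theorem IsIncreasingLinearBij.exists_dilation {g : unitInterval → unitInterval}
    {u v w : unitInterval} (huv : u < v) (hvw : v < w)
    (h : IsIncreasingLinearBij g (Icc u v) (Icc u w)) :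
    ∃ m : ℝ, 1 < m ∧ ∀ t ∈ Icc u v, (g t : ℝ) - u = m * ((t : ℝ) - u) := by
  obtain ⟨hb, m, k, hm, hg⟩ := h
  have hu : u ∈ Icc u v := ⟨le_rfl, huv.le⟩
  have hv : v ∈ Icc u v := ⟨huv.le, le_rfl⟩
  obtain ⟨t, ht, htu⟩ := hb.surjOn (show u ∈ Icc u w from ⟨le_rfl, (huv.trans hvw).le⟩)
  obtain ⟨s, hs, hsw⟩ := hb.surjOn (show w ∈ Icc u w from ⟨(huv.trans hvw).le, le_rfl⟩)
  have h1 : (u : ℝ) ≤ g u := (hb.mapsTo hu).1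
  have h2 : (u : ℝ) ≤ t := ht.1
  have h3 : (s : ℝ) ≤ v := hs.2
  have h4 := hg t ht
  have h5 := hg s hs
  have h6 := hg u hu
  rw [htu] at h4
  rw [hsw] at h5
  -- The preimage `t` of `u` satisfies `u ≤ t`, so monotonicity gives `g u ≤ g t = u`.
  have h7 : (g u : ℝ) = u := by nlinarith
  have huv' : (u : ℝ) < v := huv
  have hvw' : (v : ℝ) < w := hvw
  refine ⟨m, ?_, fun r hr => ?_⟩
  · nlinarith
  · rw [hg r hr]; linarith

/-- The inverse branch contracts `[u, w]` into `[u, v]` towards `u`, so it can be iterated from `x`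
and converges geometrically to `u`. -/
theorem mem_specialAlphaLimit_of_dilation {f : unitInterval → unitInterval} {k : ℕ} (hk : 0 < k)
    {u v w x : unitInterval} (huv : u < v) (hvw : v < w)
    (h : IsIncreasingLinearBij f^[k] (Icc u v) (Icc u w)) (hx : x ∈ Icc u w) :
    u ∈ specialAlphaLimit f x := by
  obtain ⟨m, hm, hd⟩ := h.exists_dilation huv hvw
  have hstep : ∀ z : Icc u w, ∃ z' : Icc u w, (z' : unitInterval) ∈ Icc u v ∧ f^[k] z' = z := by
    rintro ⟨z, hz⟩
    obtain ⟨z', hz', e⟩ := h.1.surjOn hz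
    exact ⟨⟨z', hz'.1, hz'.2.trans hvw.le⟩, hz', e⟩
  choose φ hφA hφ using hstep
  let c : ℕ → Icc u w := fun n => φ^[n] ⟨x, hx⟩
  have hcs : ∀ n, c (n + 1) = φ (c n) := fun n => Function.iterate_succ_apply' _ _ _
  have hc : IsBackwardBranch f^[k] x (fun n => (c n : unitInterval)) :=
    ⟨rfl, fun n => by simp only [hcs, hφ]⟩
  have hval : ∀ n, ((c n : unitInterval) : ℝ) = u + ((x : ℝ) - u) * m⁻¹ ^ n := by
    intro n
    induction n with
    | zero => simp [c]
    | succ n ih =>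
      have e := hd _ (hφA (c n))
      rw [hφ, ih] at e
      rw [hcs, pow_succ]
      field_simp
      field_simp at e
      linarith
  obtain ⟨hb1, hb2⟩ := hc.of_iterate hk
  refine ⟨_, hb1, fun i => k * i, strictMono_mul_left_of_pos hk, ?_⟩
  simp only [hb2]
  rw [tendsto_subtype_rng]
  simp only [hval]
  have : Tendsto (fun n => m⁻¹ ^ n) atTop (𝓝 0) :=
    tendsto_pow_atTop_nhds_zero_of_lt_one (by positivity) (inv_lt_one_of_one_lt₀ hm)
  simpa using (this.const_mul ((x : ℝ) - u)).const_add (u : ℝ)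

/-! ### Failure of closedness for every Chu–Xiong map. -/

namespace ChuXiongIntervals

variable (S : ChuXiongIntervals)

theorem a_strictMono : StrictMono S.a := strictMono_nat_of_lt_succ S.a_lt

theorem b_strictAnti : StrictAnti S.b :=
  strictAnti_nat_of_succ_lt fun n => (S.b_lt_c n).trans ((S.c_lt_d n).trans (S.d_lt_b n))

theorem Icc_subset_J (n : ℕ) : Icc S.x S.y ⊆ S.J n := by
  rw [← S.iInter_eq]; exact iInter_subset _ n

theorem x_mem_J (n : ℕ) : S.x ∈ S.J n := S.Icc_subset_J n ⟨le_rfl, S.x_lt_y.le⟩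

theorem y_mem_J (n : ℕ) : S.y ∈ S.J n := S.Icc_subset_J n ⟨S.x_lt_y.le, le_rfl⟩

theorem a_lt_x (n : ℕ) : S.a n < S.x := (S.a_lt n).trans_le (S.x_mem_J (n + 1)).1

theorem x_lt_b (n : ℕ) : S.x < S.b n := S.x_lt_y.trans_le (S.y_mem_J n).2

/-- The supremum of the `a n` lies in every `J n`, hence in `[x, y]`, while no `a n` exceeds `x`. -/
theorem tendsto_a : Tendsto S.a atTop (𝓝 S.x) := by
  have h := tendsto_atTop_ciSup S.a_strictMono.monotone (OrderTop.bddAbove _)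
  have hle : ⨆ n, S.a n ≤ S.x := ciSup_le fun n => (S.a_lt_x n).le
  have hmem : ⨆ n, S.a n ∈ ⋂ n, Icc (S.a n) (S.b n) :=
    mem_iInter.2 fun n => ⟨le_ciSup (OrderTop.bddAbove (range S.a)) n, hle.trans (S.x_lt_b n).le⟩
  rw [S.iInter_eq] at hmem
  rwa [le_antisymm hle hmem.1] at h

theorem A_union (n : ℕ) : S.A n ∪ S.J (n + 1) ∪ S.B n = Icc (S.a n) (S.c n) := by
  rw [A, J, B, Icc_union_Icc_eq_Icc (S.a_lt n).le (S.a_lt_b n).le,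
    Icc_union_Icc_eq_Icc ((S.a_lt n).trans (S.a_lt_b n)).le (S.b_lt_c n).le]

end ChuXiongIntervals

namespace IsChuXiongMap

variable {S : ChuXiongIntervals} {f : unitInterval → unitInterval}

theorem a_mem_specialAlphaLimit (h : IsChuXiongMap S f) (n : ℕ) :
    S.a n ∈ specialAlphaLimit f S.x := by
  have hA := h.on_A n
  rw [S.A_union] at hA
  exact mem_specialAlphaLimit_of_dilation (by positivity) (S.a_lt n)
    ((S.a_lt_b n).trans (S.b_lt_c n)) hA
    ⟨(S.a_lt_x n).le, (S.x_lt_b (n + 1)).le.trans (S.b_lt_c n).le⟩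

/-- The images of `J n` repeat with period `2 ^ n` and are disjoint within one period. -/
theorem dvd_of_iterate_mem (h : IsChuXiongMap S f) {n i : ℕ} {t : unitInterval}
    (ht : t ∈ S.J n) (hi : f^[i] t ∈ S.J n) : 2 ^ n ∣ i := by
  obtain ⟨hpos, -, hdisj, hper⟩ := h.periodic n
  by_contra hd
  have hne : i % 2 ^ n ≠ 0 := fun e => hd (Nat.dvd_of_mod_eq_zero e)
  have hmem : f^[i] t ∈ f^[i % 2 ^ n] '' S.J n :=
    image_iterate_mod hper i ▸ mem_image_of_mem _ ht
  exact disjoint_left.1 (hdisj _ (Nat.mod_lt _ hpos) 0 hpos hne) hmem (by simpa using hi)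

theorem x_notMem_specialAlphaLimit (h : IsChuXiongMap S f) : S.x ∉ specialAlphaLimit f S.x := by
  rintro ⟨b, hb, φ, hφ, hlim⟩
  have hnear : ∀ n, ∀ᶠ i in atTop, b (φ i) ∈ S.J n := fun n =>
    hlim (Icc_mem_nhds (S.a_lt_x n) (S.x_lt_b n))
  -- Every point of the branch is a forward image of a later one that lies in `J n`.
  have hM : ∀ n i, b i ∈ setOrbit f (S.J n) := by
    intro n i
    obtain ⟨j, hj, hij⟩ := ((hnear n).and (hφ.tendsto_atTop.eventually_ge_atTop i)).exists
    have := hb.iterate (φ j - i) i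
    rw [Nat.sub_add_cancel hij] at this
    rw [← this]
    exact iterate_mem_setOrbit (subset_setOrbit _ _ hj) _
  -- The level is taken equal to the index, so that `i < 2 ^ i` excludes a return to `J i` after `i`
  -- steps.
  have hright : ∀ i, 0 < i → S.y < b i := by
    intro i hi
    have hnot : b i ∉ S.J i := by
      intro hmem
      have hx : f^[i] (b i) = S.x := by simpa [hb.1] using hb.iterate i 0
      have := Nat.le_of_dvd hi (h.dvd_of_iterate_mem hmem (hx ▸ S.x_mem_J i))
      exact absurd this (not_le.2 i.lt_two_pow_self)
    exact (h.leftmost i).2 _ (S.y_mem_J i) _ ⟨hM i i, hnot⟩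
  have hle : S.y ≤ S.x := by
    refine ge_of_tendsto hlim ?_
    filter_upwards [hφ.tendsto_atTop.eventually_gt_atTop 0] with i hi using (hright _ hi).le
  exact absurd S.x_lt_y (not_lt.2 hle)

theorem x_mem_closure (h : IsChuXiongMap S f) : S.x ∈ closure (specialAlphaLimit f S.x) :=
  mem_closure_of_tendsto S.tendsto_a (Eventually.of_forall h.a_mem_specialAlphaLimit)

theorem not_isClosed_specialAlphaLimit (h : IsChuXiongMap S f) :
    ¬ IsClosed (specialAlphaLimit f S.x) := fun hc =>
  h.x_notMem_specialAlphaLimit (hc.closure_eq ▸ h.x_mem_closure)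

end IsChuXiongMap

/-! ### Entropy bounded by the growth of variation. -/

theorem eVariationOn_Iic_add_edist_le {X E : Type*} [LinearOrder X] [PseudoEMetricSpace E]
    (f : X → E) {s t : X} (h : s ≤ t) :
    eVariationOn f (Iic s) + edist (f s) (f t) ≤ eVariationOn f (Iic t) := by
  calc eVariationOn f (Iic s) + edist (f s) (f t)
      ≤ eVariationOn f (Iic s) + eVariationOn f (Icc s t) := by
        gcongr
        exact eVariationOn.edist_le f (left_mem_Icc.2 h) (right_mem_Icc.2 h)
    _ ≤ eVariationOn f (Iic s ∪ Icc s t) :=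
        eVariationOn.add_le_union f fun x hx y hy => le_trans hx hy.1
    _ ≤ eVariationOn f (Iic t) := eVariationOn.mono f
        (union_subset (Iic_subset_Iic.2 h) fun _ hx => hx.2)

/-- If the variations of the first `n` iterates of `f` have sum at most `H`, then there is an
`(n, ε)`-dynamical cover by at most `H / ε + 1` points. -/
theorem coverMincard_le_of_sum_eVariationOn_le {X : Type*} [LinearOrder X] [PseudoMetricSpace X]
    (f : X → X) {n : ℕ} {H ε : ℝ} (hε : 0 < ε)
    (hfin : ∀ i < n, eVariationOn f^[i] univ ≠ ∞)
    (hH : ∑ i ∈ Finset.range n, (eVariationOn f^[i] univ).toReal ≤ H) :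
    Dynamics.coverMincard f univ {p | dist p.1 p.2 < ε} n ≤ (⌊H / ε⌋₊ + 1 : ℕ) := by
  classical
  rcases isEmpty_or_nonempty X with hX | hX
  · simp [univ_eq_empty_iff.2 hX]
  have hfin' : ∀ i < n, ∀ t, eVariationOn f^[i] (Iic t) ≠ ∞ := fun i hi t =>
    ne_top_of_le_ne_top (hfin i hi) (eVariationOn.mono _ (subset_univ _))
  -- The summed variation functions give one coordinate whose increments dominate the distances
  -- under all of the first `n` iterates at once.
  let h : X → ℝ := fun t => ∑ i ∈ Finset.range n, (eVariationOn f^[i] (Iic t)).toReal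
  have h_nonneg : ∀ t, 0 ≤ h t := fun t => Finset.sum_nonneg fun _ _ => ENNReal.toReal_nonneg
  have h_le : ∀ t, h t ≤ H := fun t => le_trans (Finset.sum_le_sum fun i hi =>
    ENNReal.toReal_mono (hfin i (Finset.mem_range.1 hi)) (eVariationOn.mono _ (subset_univ _))) hH
  have hdist : ∀ i < n, ∀ s t, s ≤ t → dist (f^[i] s) (f^[i] t) ≤ h t - h s := by
    intro i hi s t hst
    have key : ∀ j < n, dist (f^[j] s) (f^[j] t) ≤ (eVariationOn f^[j] (Iic t)).toReal -
        (eVariationOn f^[j] (Iic s)).toReal := by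
      intro j hj
      have := ENNReal.toReal_mono (hfin' j hj t) (eVariationOn_Iic_add_edist_le f^[j] hst)
      rw [ENNReal.toReal_add (hfin' j hj s) (edist_ne_top _ _), ← dist_edist] at this
      linarith
    calc dist (f^[i] s) (f^[i] t)
        ≤ ∑ j ∈ Finset.range n, dist (f^[j] s) (f^[j] t) :=
          Finset.single_le_sum (f := fun j => dist (f^[j] s) (f^[j] t))
            (fun _ _ => dist_nonneg) (Finset.mem_range.2 hi)
      _ ≤ ∑ j ∈ Finset.range n, ((eVariationOn f^[j] (Iic t)).toReal -
            (eVariationOn f^[j] (Iic s)).toReal) :=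
          Finset.sum_le_sum fun j hj => key j (Finset.mem_range.1 hj)
      _ = h t - h s := Finset.sum_sub_distrib _ _
  have hdist' : ∀ i < n, ∀ s t, dist (f^[i] s) (f^[i] t) ≤ |h s - h t| := by
    intro i hi s t
    rcases le_total s t with hst | hst
    · rw [abs_sub_comm]; exact (hdist i hi s t hst).trans (le_abs_self _)
    · rw [dist_comm]; exact (hdist i hi t s hst).trans (le_abs_self _)
  -- The values of `h` are sorted into bins of width `ε`; one representative of each nonempty bin
  -- suffices for the cover.
  let φ : X → ℕ := fun t => ⌊h t / ε⌋₊
  have hcover : Dynamics.IsDynCoverOf f univ {p | dist p.1 p.2 < ε} n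
      ((Finset.range (⌊H / ε⌋₊ + 1)).image (Function.invFun φ) : Finset X) := by
    intro t _
    have hφ : φ (Function.invFun φ (φ t)) = φ t := Function.invFun_eq ⟨t, rfl⟩
    refine ⟨Function.invFun φ (φ t), ?_, ?_⟩
    · refine Finset.mem_coe.2 (Finset.mem_image_of_mem _ (Finset.mem_range.2 ?_))
      exact Nat.lt_succ_of_le (Nat.floor_le_floor (div_le_div_of_nonneg_right (h_le t) hε.le))
    · rw [Dynamics.mem_dynEntourage]
      intro i hi
      refine (hdist' i hi _ _).trans_lt ?_
      set s := Function.invFun φ (φ t)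
      have h1 := Nat.floor_le (div_nonneg (h_nonneg s) hε.le)
      have h2 := Nat.lt_floor_add_one (h s / ε)
      have h3 := Nat.floor_le (div_nonneg (h_nonneg t) hε.le)
      have h4 := Nat.lt_floor_add_one (h t / ε)
      change ⌊h s / ε⌋₊ = ⌊h t / ε⌋₊ at hφ
      rw [hφ] at h1 h2
      have h5 : |h t / ε - h s / ε| < 1 := by rw [abs_lt]; constructor <;> linarith
      rw [← sub_div, abs_div, abs_of_pos hε, div_lt_one hε] at h5
      exact h5
  refine hcover.coverMincard_le_card.trans ?_
  exact_mod_cast Finset.card_image_le.trans (by simp)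

/-- The sequence `u` grows at most exponentially with rate `r`. -/
def ExpBounded (r : ℝ≥0) (u : ℕ → ℝ≥0∞) : Prop := ∃ C : ℝ≥0, ∀ n, u n ≤ C * (r : ℝ≥0∞) ^ n

theorem coverEntropy_le_log_of_expBounded {X : Type*} [LinearOrder X] [PseudoMetricSpace X]
    (f : X → X) {r : ℝ≥0} (hr : 1 < r)
    (h : ExpBounded r fun n => eVariationOn f^[n] univ) :
    Dynamics.coverEntropy f univ ≤ ENNReal.log r := by
  obtain ⟨C, hC⟩ := h
  have hr' : (1 : ℝ) < r := hr
  have hC' : ∀ n, eVariationOn f^[n] univ ≤ ((C * r ^ n : ℝ≥0) : ℝ≥0∞) := fun n => by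
    simpa using hC n
  have hH : ∀ n, ∑ i ∈ Finset.range n, (eVariationOn f^[i] univ).toReal ≤
      C * ((r : ℝ) ^ n / (r - 1)) := by
    intro n
    calc ∑ i ∈ Finset.range n, (eVariationOn f^[i] univ).toReal
        ≤ ∑ i ∈ Finset.range n, (C : ℝ) * (r : ℝ) ^ i := Finset.sum_le_sum fun i _ => by
          have := ENNReal.toReal_mono ENNReal.coe_ne_top (hC' i)
          simpa using this
      _ = C * (((r : ℝ) ^ n - 1) / (r - 1)) := by
          rw [← Finset.mul_sum, geom_sum_eq hr'.ne']
      _ ≤ _ := by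
          have : (0 : ℝ) < r - 1 := by linarith
          gcongr
          linarith
  rw [Dynamics.coverEntropy_eq_iSup_basis Metric.uniformity_basis_dist]
  refine iSup₂_le fun ε hε => ?_
  -- With `log r` written as the growth rate of `r ^ n`, a bound up to a constant factor suffices;
  -- the extra `1` in the cover count is absorbed by `1 ≤ r ^ n`.
  rw [← ExpGrowth.expGrowthSup_pow (b := (r : ℝ≥0∞))]
  refine ExpGrowth.expGrowthSup_le_of_eventually_le
    (b := ENNReal.ofReal (C / (r - 1) / ε + 1)) ENNReal.ofReal_ne_top (Eventually.of_forall fun n => ?_)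
  have h1 := coverMincard_le_of_sum_eVariationOn_le f hε
    (fun i _ => ne_top_of_le_ne_top ENNReal.coe_ne_top (hC' i)) (hH n)
  have h2 : (Dynamics.coverMincard f univ {p | dist p.1 p.2 < ε} n : ℝ≥0∞) ≤
      ((⌊C * ((r : ℝ) ^ n / (r - 1)) / ε⌋₊ + 1 : ℕ) : ℝ≥0∞) := by
    simpa using ENat.toENNReal_mono h1
  refine h2.trans ?_
  rw [← ENNReal.ofReal_natCast, ← ENNReal.ofReal_coe_nnreal, ← ENNReal.ofReal_pow (by positivity),
    ← ENNReal.ofReal_mul (by have : (0 : ℝ) < r - 1 := by linarith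
                             positivity)]
  apply ENNReal.ofReal_le_ofReal
  have hpos : (0 : ℝ) < r - 1 := by linarith
  have h3 := Nat.floor_le (show 0 ≤ C * ((r : ℝ) ^ n / (r - 1)) / ε by positivity)
  have h4 : (1 : ℝ) ≤ r ^ n := one_le_pow₀ hr'.le
  push_cast
  calc _ ≤ C * ((r : ℝ) ^ n / (r - 1)) / ε + r ^ n := add_le_add h3 h4
    _ = _ := by ring

theorem coverEntropy_eq_zero_of_expBounded {X : Type*} [LinearOrder X] [PseudoMetricSpace X]
    [Nonempty X] (f : X → X)
    (h : ∀ r : ℝ≥0, 1 < r → ExpBounded r fun n => eVariationOn f^[n] univ) :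
    Dynamics.coverEntropy f univ = 0 := by
  refine le_antisymm ?_ (Dynamics.coverEntropy_nonneg f univ_nonempty)
  have hlim : Tendsto (fun r : ℝ≥0 => ENNReal.log r) (𝓝[>] 1) (𝓝 0) := by
    have := (ENNReal.continuous_log.comp ENNReal.continuous_coe).tendsto (1 : ℝ≥0)
    simp only [Function.comp_apply, ENNReal.coe_one, ENNReal.log_one] at this
    exact this.mono_left nhdsWithin_le_nhds
  refine ge_of_tendsto hlim ?_
  filter_upwards [self_mem_nhdsWithin] with r hr
  exact coverEntropy_le_log_of_expBounded f hr (h r hr)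

theorem ExpBounded.mono {r : ℝ≥0} {u v : ℕ → ℝ≥0∞} (hv : ExpBounded r v) (h : ∀ n, u n ≤ v n) :
    ExpBounded r u := by
  obtain ⟨C, hC⟩ := hv
  exact ⟨C, fun n => (h n).trans (hC n)⟩

theorem ExpBounded.add {r : ℝ≥0} {u v : ℕ → ℝ≥0∞} (hu : ExpBounded r u) (hv : ExpBounded r v) :
    ExpBounded r fun n => u n + v n := by
  obtain ⟨C, hC⟩ := hu
  obtain ⟨D, hD⟩ := hv
  refine ⟨C + D, fun n => ?_⟩
  push_cast
  rw [add_mul]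
  exact add_le_add (hC n) (hD n)

/-- A sequence whose increments are exponentially bounded with rate `r > 1` is so itself. -/
theorem ExpBounded.of_succ_le {r : ℝ≥0} (hr : 1 < r) {u v : ℕ → ℝ≥0∞} (hv : ExpBounded r v)
    (h0 : u 0 ≠ ∞) (h : ∀ n, u (n + 1) ≤ u n + v n) : ExpBounded r u := by
  obtain ⟨D, hD⟩ := hv
  have hpos : 0 < r - 1 := tsub_pos_of_lt hr
  -- This constant `C` satisfies `D ≤ C * (r - 1)`, hence `C + D ≤ C * r`, which closes the
  -- induction.
  refine ⟨(u 0).toNNReal + D / (r - 1), fun n => ?_⟩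
  induction n with
  | zero => simp [ENNReal.coe_toNNReal h0]
  | succ n ih =>
    refine (h n).trans ((add_le_add ih (hD n)).trans ?_)
    norm_cast
    rw [pow_succ, ← add_mul, mul_comm (r ^ n), ← mul_assoc]
    gcongr
    set C := (u 0).toNNReal + D / (r - 1)
    calc C + D = C + D / (r - 1) * (r - 1) := by rw [div_mul_cancel₀ _ hpos.ne']
      _ ≤ C + C * (r - 1) := by gcongr; exact le_add_self
      _ = C * (1 + (r - 1)) := by ring
      _ = C * r := by rw [add_tsub_cancel_of_le hr.le]

/-! ### The example: explicit intervals and renormalised return maps. -/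

namespace ChuXiongExample

/-- The scale `2⁻ⁿ` of level `n`. -/
noncomputable def scale (n : ℕ) : ℝ := (1 / 2) ^ n

/-- Left endpoint of `J n`. -/
noncomputable def ptA (n : ℕ) : ℝ := (1 - scale n) / 4

/-- Right endpoint of `J n`. -/
noncomputable def ptB (n : ℕ) : ℝ := (1 + scale n) / 2

/-- Left endpoint of `K (n + 1)`. -/
noncomputable def ptC (n : ℕ) : ℝ := 1 / 2 + 3 * scale n / 8

/-- Right endpoint of `K (n + 1)`. -/
noncomputable def ptD (n : ℕ) : ℝ := 1 / 2 + 7 * scale n / 16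

/-- The ratio of the lengths of `K (n + 1)` and `J (n + 1)`. -/
noncomputable def ratio (n : ℕ) : ℝ := scale n / (4 + 6 * scale n)

theorem scale_pos (n : ℕ) : 0 < scale n := by unfold scale; positivity

theorem scale_le_one (n : ℕ) : scale n ≤ 1 := pow_le_one₀ (by norm_num) (by norm_num)

theorem scale_succ (n : ℕ) : scale (n + 1) = scale n / 2 := by
  unfold scale; rw [pow_succ]; ring

theorem scale_mul_two_pow (n : ℕ) : scale n * 2 ^ n = 1 := by
  unfold scale; rw [← mul_pow]; norm_num

theorem ratio_pos (n : ℕ) : 0 < ratio n := by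
  have := scale_pos n
  unfold ratio; positivity

theorem ratio_le (n : ℕ) : ratio n ≤ 1 / 4 := by
  have := scale_pos n
  have := scale_le_one n
  unfold ratio
  rw [div_le_div_iff₀ (by positivity) (by norm_num)]
  linarith

theorem ptA_lt (n : ℕ) : ptA n < ptA (n + 1) := by
  have := scale_pos n
  unfold ptA; rw [scale_succ]; linarith

theorem ptA_lt_ptB (n : ℕ) : ptA n < ptB n := by
  have := scale_pos n
  unfold ptA ptB; linarith

theorem ptB_lt_ptC (n : ℕ) : ptB (n + 1) < ptC n := by
  have := scale_pos n
  unfold ptB ptC; rw [scale_succ]; linarith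

theorem ptC_lt_ptD (n : ℕ) : ptC n < ptD n := by
  have := scale_pos n
  unfold ptC ptD; linarith

theorem ptD_lt_ptB (n : ℕ) : ptD n < ptB n := by
  have := scale_pos n
  unfold ptD ptB; linarith

theorem ptA_nonneg (n : ℕ) : 0 ≤ ptA n := by
  have := scale_le_one n
  unfold ptA; linarith

theorem ptB_le_one (n : ℕ) : ptB n ≤ 1 := by
  have := scale_le_one n
  unfold ptB; linarith

theorem ratio_mul (n : ℕ) : ratio n * (ptB (n + 1) - ptA (n + 1)) = ptD n - ptC n := by
  have := scale_pos n
  unfold ratio ptA ptB ptC ptD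
  rw [scale_succ]
  field_simp
  ring

/-- A piecewise affine function supported in `J n`, the difference of the identity and of the
piecewise affine map of `J n` mapping `A n`, `J (n + 1)`, `B n`, `K (n + 1)`, `C n` as prescribed. -/
noncomputable def bump (n : ℕ) (t : ℝ) : ℝ :=
  -- Each coefficient is the jump of slope at its breakpoint. Inside `J n` the slopes of `t + bump n
  -- t` are `2 / scale n + 5`, `ratio n`, `-(2 / scale n + 9 / 2)`, `4 / scale n + 6` and `4`.
  (2 / scale n + 4) * max (t - ptA n) 0 +
  (ratio n - 1 - (2 / scale n + 4)) * max (t - ptA (n + 1)) 0 +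
  (-(2 / scale n + 11 / 2) - (ratio n - 1)) * max (t - ptB (n + 1)) 0 +
  (4 / scale n + 5 + (2 / scale n + 11 / 2)) * max (t - ptC n) 0 +
  (3 - (4 / scale n + 5)) * max (t - ptD n) 0 - 3 * max (t - ptB n) 0

section Pieces

variable {n : ℕ} {t : ℝ}

theorem bump_of_le (h : t ≤ ptA n) : bump n t = 0 := by
  have h1 := ptA_lt n
  have h2 := ptA_lt_ptB (n + 1)
  have h3 := ptB_lt_ptC n
  have h4 := ptC_lt_ptD n
  have h5 := ptD_lt_ptB n
  unfold bump
  rw [max_eq_right (by linarith), max_eq_right (by linarith), max_eq_right (by linarith),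
    max_eq_right (by linarith), max_eq_right (by linarith), max_eq_right (by linarith)]
  ring

theorem bump_on_A (h : t ∈ Icc (ptA n) (ptA (n + 1))) :
    t + bump n t = ptA n + (2 / scale n + 5) * (t - ptA n) := by
  obtain ⟨h0, h0'⟩ := h
  have h2 := ptA_lt_ptB (n + 1)
  have h3 := ptB_lt_ptC n
  have h4 := ptC_lt_ptD n
  have h5 := ptD_lt_ptB n
  unfold bump
  rw [max_eq_left (by linarith), max_eq_right (by linarith), max_eq_right (by linarith),
    max_eq_right (by linarith), max_eq_right (by linarith), max_eq_right (by linarith)]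
  ring

theorem bump_on_J (h : t ∈ Icc (ptA (n + 1)) (ptB (n + 1))) :
    t + bump n t = ptC n + ratio n * (t - ptA (n + 1)) := by
  obtain ⟨h0, h0'⟩ := h
  have h1 := ptA_lt n
  have h3 := ptB_lt_ptC n
  have h4 := ptC_lt_ptD n
  have h5 := ptD_lt_ptB n
  have hs := scale_pos n
  unfold bump
  rw [max_eq_left (by linarith), max_eq_left (by linarith), max_eq_right (by linarith),
    max_eq_right (by linarith), max_eq_right (by linarith), max_eq_right (by linarith)]
  unfold ptA ptC
  rw [scale_succ]
  field_simp
  ring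

theorem bump_on_B (h : t ∈ Icc (ptB (n + 1)) (ptC n)) :
    t + bump n t = ptD n - (2 / scale n + 9 / 2) * (t - ptB (n + 1)) := by
  obtain ⟨h0, h0'⟩ := h
  have h1 := ptA_lt n
  have h2 := ptA_lt_ptB (n + 1)
  have h4 := ptC_lt_ptD n
  have h5 := ptD_lt_ptB n
  have hs := scale_pos n
  unfold bump
  rw [max_eq_left (by linarith), max_eq_left (by linarith), max_eq_left (by linarith),
    max_eq_right (by linarith), max_eq_right (by linarith), max_eq_right (by linarith)]
  unfold ptA ptB ptD ratio
  rw [scale_succ]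
  field_simp
  ring

theorem bump_on_K (h : t ∈ Icc (ptC n) (ptD n)) :
    t + bump n t = ptA (n + 1) + (4 / scale n + 6) * (t - ptC n) := by
  obtain ⟨h0, h0'⟩ := h
  have h1 := ptA_lt n
  have h2 := ptA_lt_ptB (n + 1)
  have h3 := ptB_lt_ptC n
  have h5 := ptD_lt_ptB n
  have hs := scale_pos n
  unfold bump
  rw [max_eq_left (by linarith), max_eq_left (by linarith), max_eq_left (by linarith),
    max_eq_left (by linarith), max_eq_right (by linarith), max_eq_right (by linarith)]
  unfold ptA ptB ptC ratio
  rw [scale_succ]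
  field_simp
  ring

theorem bump_on_C (h : t ∈ Icc (ptD n) (ptB n)) :
    t + bump n t = ptB (n + 1) + 4 * (t - ptD n) := by
  obtain ⟨h0, h0'⟩ := h
  have h1 := ptA_lt n
  have h2 := ptA_lt_ptB (n + 1)
  have h3 := ptB_lt_ptC n
  have h4 := ptC_lt_ptD n
  have hs := scale_pos n
  unfold bump
  rw [max_eq_left (by linarith), max_eq_left (by linarith), max_eq_left (by linarith),
    max_eq_left (by linarith), max_eq_left (by linarith), max_eq_right (by linarith)]
  unfold ptA ptB ptC ptD ratio
  rw [scale_succ]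
  field_simp
  ring

theorem bump_of_ge (h : ptB n ≤ t) : bump n t = 0 := by
  have h1 := ptA_lt n
  have h2 := ptA_lt_ptB (n + 1)
  have h3 := ptB_lt_ptC n
  have h4 := ptC_lt_ptD n
  have h5 := ptD_lt_ptB n
  have hs := scale_pos n
  unfold bump
  rw [max_eq_left (by linarith), max_eq_left (by linarith), max_eq_left (by linarith),
    max_eq_left (by linarith), max_eq_left (by linarith), max_eq_left (by linarith)]
  unfold ptA ptB ptC ptD ratio
  rw [scale_succ]
  field_simp
  ring

end Pieces

theorem abs_bump_sub_le (n : ℕ) (s t : ℝ) : |bump n s - bump n t| ≤ 50 * 2 ^ n * |s - t| := by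
  have hs := scale_pos n
  have hinv : (2 : ℝ) ^ n = 1 / scale n := by
    rw [eq_div_iff hs.ne', mul_comm]; exact scale_mul_two_pow n
  have hone : 1 ≤ 1 / scale n := by rw [← hinv]; exact one_le_pow₀ (by norm_num)
  have hr := ratio_pos n
  have hr' := ratio_le n
  have hinge : ∀ k c M : ℝ, |c| ≤ M →
      |c * max (s - k) 0 - c * max (t - k) 0| ≤ M * |s - t| := by
    intro k c M hc
    rw [← mul_sub, abs_mul]
    refine mul_le_mul hc ?_ (abs_nonneg _) ((abs_nonneg _).trans hc)
    simpa using abs_max_sub_max_le_abs (s - k) (t - k) 0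
  -- Crude bounds for the six slope jumps, using `1 ≤ 1 / scale n`; they add up to `50 = 6 + 7 + 9 +
  -- 17 + 6 + 5`.
  have e1 := hinge (ptA n) (2 / scale n + 4) (6 * (1 / scale n))
    (by rw [abs_le]; constructor <;> ring_nf at * <;> linarith)
  have e2 := hinge (ptA (n + 1)) (ratio n - 1 - (2 / scale n + 4)) (7 * (1 / scale n))
    (by rw [abs_le]; constructor <;> ring_nf at * <;> linarith)
  have e3 := hinge (ptB (n + 1)) (-(2 / scale n + 11 / 2) - (ratio n - 1)) (9 * (1 / scale n))
    (by rw [abs_le]; constructor <;> ring_nf at * <;> linarith)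
  have e4 := hinge (ptC n) (4 / scale n + 5 + (2 / scale n + 11 / 2)) (17 * (1 / scale n))
    (by rw [abs_le]; constructor <;> ring_nf at * <;> linarith)
  have e5 := hinge (ptD n) (3 - (4 / scale n + 5)) (6 * (1 / scale n))
    (by rw [abs_le]; constructor <;> ring_nf at * <;> linarith)
  have e6 := hinge (ptB n) 3 (5 * (1 / scale n))
    (by rw [abs_le]; constructor <;> ring_nf at * <;> linarith)
  rw [abs_le] at e1 e2 e3 e4 e5 e6
  rw [hinv]
  unfold bump
  rw [abs_le]
  constructor <;> linarith

/-- The product of `n` consecutive ratios, from level `m` on. -/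
noncomputable def weight (m n : ℕ) : ℝ := ∏ k ∈ Finset.range n, ratio (m + k)

theorem weight_zero (m : ℕ) : weight m 0 = 1 := by simp [weight]

theorem weight_succ (m n : ℕ) : weight m (n + 1) = ratio m * weight (m + 1) n := by
  unfold weight
  rw [Finset.prod_range_succ', mul_comm]
  simp only [Nat.add_zero]
  congr 1
  exact Finset.prod_congr rfl fun k _ => by congr 1; ring

theorem weight_nonneg (m n : ℕ) : 0 ≤ weight m n :=
  Finset.prod_nonneg fun _ _ => (ratio_pos _).le

theorem weight_le (m n : ℕ) : weight m n ≤ (1 / 4) ^ n := by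
  refine (Finset.prod_le_prod (fun _ _ => (ratio_pos _).le) fun k _ => ratio_le (m + k)).trans ?_
  simp

/-- Steepness grows like `2 ^ n` but the weights decay like `4 ^ (-n)`, so the series of corrections
is dominated by a geometric one, with Lipschitz bounds. -/
theorem abs_weight_mul_bump_sub_le (m n : ℕ) (s t : ℝ) :
    |weight m n * bump (m + n) s - weight m n * bump (m + n) t| ≤
      50 * 2 ^ m * |s - t| * (1 / 2) ^ n := by
  rw [← mul_sub, abs_mul, abs_of_nonneg (weight_nonneg m n)]
  calc weight m n * |bump (m + n) s - bump (m + n) t|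
      ≤ (1 / 4) ^ n * (50 * 2 ^ (m + n) * |s - t|) :=
        mul_le_mul (weight_le m n) (abs_bump_sub_le _ _ _) (abs_nonneg _) (by positivity)
    _ = 50 * 2 ^ m * |s - t| * ((1 / 4) ^ n * 2 ^ n) := by rw [pow_add]; ring
    _ = _ := by rw [← mul_pow]; norm_num

theorem summable_weight_mul_bump (m : ℕ) (t : ℝ) :
    Summable fun n => weight m n * bump (m + n) t := by
  refine Summable.of_norm_bounded
    (g := fun n => 50 * 2 ^ m * |t - 0| * (1 / 2 : ℝ) ^ n) ?_ fun n => ?_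
  · exact summable_geometric_two.mul_left _
  · have := abs_weight_mul_bump_sub_le m n t 0
    rwa [bump_of_le (ptA_nonneg (m + n)), mul_zero, sub_zero] at this

/-- The return map to `J m`, extended by the identity. -/
noncomputable def returnMap (m : ℕ) (t : ℝ) : ℝ := t + ∑' n, weight m n * bump (m + n) t

/-- Self-similarity: after the first term, the series is `ratio m` times the series of the next
level. -/
theorem returnMap_eq (m : ℕ) (t : ℝ) :
    returnMap m t = t + bump m t + ratio m * (returnMap (m + 1) t - t) := by
  unfold returnMap
  rw [(summable_weight_mul_bump m t).tsum_eq_zero_add]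
  simp only [weight_succ, weight_zero, Nat.add_zero, add_sub_cancel_left, mul_assoc]
  rw [tsum_mul_left]
  simp only [add_assoc, one_mul, add_comm 1]

theorem returnMap_of_le {m : ℕ} {t : ℝ} (h : t ≤ ptA m) : returnMap m t = t := by
  have hmono : Monotone ptA := monotone_nat_of_le_succ fun n => (ptA_lt n).le
  unfold returnMap
  simp [fun n => bump_of_le (h.trans (hmono (Nat.le_add_right m n)))]

theorem ptB_antitone : Antitone ptB := antitone_nat_of_succ_le fun n =>
  ((ptB_lt_ptC n).trans ((ptC_lt_ptD n).trans (ptD_lt_ptB n))).le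

theorem returnMap_of_ge {m : ℕ} {t : ℝ} (h : ptB m ≤ t) : returnMap m t = t := by
  unfold returnMap
  simp [fun n => bump_of_ge ((ptB_antitone (Nat.le_add_right m n)).trans h)]

theorem lipschitzWith_returnMap (m : ℕ) : LipschitzWith (101 * 2 ^ m) (returnMap m) := by
  refine LipschitzWith.of_dist_le_mul fun s t => ?_
  rw [Real.dist_eq, Real.dist_eq]
  have hS := (summable_weight_mul_bump m s).sub (summable_weight_mul_bump m t)
  have hG : Summable fun n => 50 * 2 ^ m * |s - t| * (1 / 2 : ℝ) ^ n :=
    summable_geometric_two.mul_left _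
  have h1 : |∑' n, (weight m n * bump (m + n) s - weight m n * bump (m + n) t)| ≤
      100 * 2 ^ m * |s - t| := by
    rw [← Real.norm_eq_abs]
    refine (tsum_of_norm_bounded hG.hasSum fun n =>
      (Real.norm_eq_abs _).trans_le (abs_weight_mul_bump_sub_le m n s t)).trans ?_
    rw [tsum_mul_left, tsum_geometric_two]
    linarith
  have h2 : returnMap m s - returnMap m t = (s - t) +
      ∑' n, (weight m n * bump (m + n) s - weight m n * bump (m + n) t) := by
    rw [(summable_weight_mul_bump m s).tsum_sub (summable_weight_mul_bump m t)]
    unfold returnMap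
    ring
  rw [h2]
  refine (abs_add_le _ _).trans ?_
  have h3 : |s - t| ≤ 2 ^ m * |s - t| :=
    le_mul_of_one_le_left (abs_nonneg _) (one_le_pow₀ (by norm_num))
  push_cast
  linarith

theorem continuous_returnMap (m : ℕ) : Continuous (returnMap m) :=
  (lipschitzWith_returnMap m).continuous

section Pieces

variable {m : ℕ} {t : ℝ}

theorem returnMap_on_A (h : t ∈ Icc (ptA m) (ptA (m + 1))) :
    returnMap m t = ptA m + (2 / scale m + 5) * (t - ptA m) := by
  rw [returnMap_eq, returnMap_of_le h.2, bump_on_A h]; ring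

theorem returnMap_on_J (h : t ∈ Icc (ptA (m + 1)) (ptB (m + 1))) :
    returnMap m t = ptC m + ratio m * (returnMap (m + 1) t - ptA (m + 1)) := by
  rw [returnMap_eq, bump_on_J h]; ring

theorem returnMap_on_B (h : t ∈ Icc (ptB (m + 1)) (ptC m)) :
    returnMap m t = ptD m - (2 / scale m + 9 / 2) * (t - ptB (m + 1)) := by
  rw [returnMap_eq, returnMap_of_ge h.1, bump_on_B h]; ring

theorem returnMap_on_K (h : t ∈ Icc (ptC m) (ptD m)) :
    returnMap m t = ptA (m + 1) + (4 / scale m + 6) * (t - ptC m) := by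
  rw [returnMap_eq, returnMap_of_ge ((ptB_lt_ptC m).le.trans h.1), bump_on_K h]; ring

theorem returnMap_on_C (h : t ∈ Icc (ptD m) (ptB m)) :
    returnMap m t = ptB (m + 1) + 4 * (t - ptD m) := by
  rw [returnMap_eq, returnMap_of_ge (((ptB_lt_ptC m).trans (ptC_lt_ptD m)).le.trans h.1),
    bump_on_C h]
  ring

theorem slope_A_mul (m : ℕ) : (2 / scale m + 5) * (ptA (m + 1) - ptA m) = ptC m - ptA m := by
  have hs := scale_pos m
  unfold ptA ptC
  rw [scale_succ]
  field_simp
  ring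

theorem slope_B_mul (m : ℕ) :
    (2 / scale m + 9 / 2) * (ptC m - ptB (m + 1)) = ptD m - ptA (m + 1) := by
  have hs := scale_pos m
  unfold ptA ptB ptC ptD
  rw [scale_succ]
  field_simp
  ring

theorem slope_K_mul (m : ℕ) :
    (4 / scale m + 6) * (ptD m - ptC m) = ptB (m + 1) - ptA (m + 1) := by
  have hs := scale_pos m
  unfold ptA ptB ptC ptD
  rw [scale_succ]
  field_simp
  ring

theorem slope_K_mul_ratio (m : ℕ) : (4 / scale m + 6) * ratio m = 1 := by
  have hs := scale_pos m
  unfold ratio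
  field_simp

theorem slope_C_mul (m : ℕ) : 4 * (ptB m - ptD m) = ptB m - ptB (m + 1) := by
  unfold ptB ptD
  rw [scale_succ]
  ring

theorem slope_A_pos (m : ℕ) : 0 < 2 / scale m + 5 := by have := scale_pos m; positivity

theorem slope_B_pos (m : ℕ) : 0 < 2 / scale m + 9 / 2 := by have := scale_pos m; positivity

theorem slope_K_pos (m : ℕ) : 0 < 4 / scale m + 6 := by have := scale_pos m; positivity

theorem mapsTo_A (m : ℕ) :
    MapsTo (returnMap m) (Icc (ptA m) (ptA (m + 1))) (Icc (ptA m) (ptC m)) := by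
  intro t h
  have h1 := slope_A_mul m
  have h2 := slope_A_pos m
  rw [returnMap_on_A h]
  constructor <;> nlinarith [h.1, h.2]

theorem mapsTo_B (m : ℕ) :
    MapsTo (returnMap m) (Icc (ptB (m + 1)) (ptC m)) (Icc (ptA (m + 1)) (ptD m)) := by
  intro t h
  have h1 := slope_B_mul m
  have h2 := slope_B_pos m
  rw [returnMap_on_B h]
  constructor <;> nlinarith [h.1, h.2]

theorem mapsTo_K (m : ℕ) :
    MapsTo (returnMap m) (Icc (ptC m) (ptD m)) (Icc (ptA (m + 1)) (ptB (m + 1))) := by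
  intro t h
  have h1 := slope_K_mul m
  have h2 := slope_K_pos m
  rw [returnMap_on_K h]
  constructor <;> nlinarith [h.1, h.2]

theorem mapsTo_C (m : ℕ) :
    MapsTo (returnMap m) (Icc (ptD m) (ptB m)) (Icc (ptB (m + 1)) (ptB m)) := by
  intro t h
  have h1 := slope_C_mul m
  rw [returnMap_on_C h]
  constructor <;> linarith [h.1, h.2]

end Pieces

/-- Invariance of `J m` hinges on that of `J (m + 1)`, an infinite regress. It is cut after `n`
levels by the Lipschitz bound; each level doubles that bound but scales it by `ratio ≤ 1 / 4`, so
the error halves. -/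
theorem returnMap_mem_Icc_of_bound (n : ℕ) : ∀ m : ℕ, ∀ t ∈ Icc (ptA m) (ptB m),
    returnMap m t ∈ Icc (ptA m - 101 * 2 ^ m * (1 / 2) ^ n) (ptB m + 101 * 2 ^ m * (1 / 2) ^ n) := by
  induction n with
  | zero =>
    intro m t ht
    have h1 := (lipschitzWith_returnMap m).dist_le_mul t (ptA m)
    rw [returnMap_of_le le_rfl, Real.dist_eq, Real.dist_eq] at h1
    have h2 : |t - ptA m| ≤ 1 := by
      have := ptA_nonneg m
      have := ptB_le_one m
      rw [abs_le]; constructor <;> linarith [ht.1, ht.2]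
    push_cast at h1
    have h3 : |returnMap m t - ptA m| ≤ 101 * 2 ^ m :=
      h1.trans (mul_le_of_le_one_right (by positivity) h2)
    rw [abs_le] at h3
    have := ptA_lt_ptB m
    simp only [pow_zero, mul_one]
    constructor <;> linarith
  | succ n ih =>
    intro m t ht
    have h1 := ptA_lt m
    have h2 := ptA_lt_ptB (m + 1)
    have h3 := ptB_lt_ptC m
    have h4 := ptC_lt_ptD m
    have h5 := ptD_lt_ptB m
    have hpos : (0 : ℝ) ≤ 101 * 2 ^ m * (1 / 2) ^ (n + 1) := by positivity
    have hwiden : Icc (ptA m) (ptB m) ⊆ Icc (ptA m - 101 * 2 ^ m * (1 / 2) ^ (n + 1))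
        (ptB m + 101 * 2 ^ m * (1 / 2) ^ (n + 1)) :=
      Icc_subset_Icc (by linarith) (by linarith)
    rcases le_total t (ptA (m + 1)) with hA | hA
    · exact hwiden (Icc_subset_Icc le_rfl (by linarith) (mapsTo_A m ⟨ht.1, hA⟩))
    rcases le_total t (ptB (m + 1)) with hJ | hJ
    · obtain ⟨l, r⟩ := ih (m + 1) t ⟨hA, hJ⟩
      rw [returnMap_on_J ⟨hA, hJ⟩]
      have hr := ratio_pos m
      have hr' := ratio_le m
      have hm := ratio_mul m
      set e : ℝ := 101 * 2 ^ m * (1 / 2) ^ (n + 1) with he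
      have he' : (101 : ℝ) * 2 ^ (m + 1) * (1 / 2) ^ n = 4 * e := by
        rw [he, pow_succ, pow_succ]; ring
      rw [he'] at l r
      have h6 : ratio m * (4 * e) ≤ e := by nlinarith
      constructor <;> nlinarith
    rcases le_total t (ptC m) with hB | hB
    · exact hwiden (Icc_subset_Icc h1.le h5.le (mapsTo_B m ⟨hJ, hB⟩))
    rcases le_total t (ptD m) with hK | hK
    · exact hwiden (Icc_subset_Icc h1.le (by linarith) (mapsTo_K m ⟨hB, hK⟩))
    · exact hwiden (Icc_subset_Icc (by linarith) le_rfl (mapsTo_C m ⟨hK, ht.2⟩))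

theorem mapsTo_returnMap (m : ℕ) :
    MapsTo (returnMap m) (Icc (ptA m) (ptB m)) (Icc (ptA m) (ptB m)) := by
  intro t ht
  have hlim : Tendsto (fun n : ℕ => 101 * 2 ^ m * (1 / 2 : ℝ) ^ n) atTop (𝓝 0) := by
    simpa using (tendsto_pow_atTop_nhds_zero_of_lt_one (by norm_num : (0 : ℝ) ≤ 1 / 2)
      (by norm_num)).const_mul (101 * 2 ^ m : ℝ)
  have h1 := hlim.const_sub (ptA m)
  have h2 := hlim.const_add (ptB m)
  rw [sub_zero] at h1
  rw [add_zero] at h2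
  exact ⟨le_of_tendsto' h1 fun n => (returnMap_mem_Icc_of_bound n m t ht).1,
    ge_of_tendsto' h2 fun n => (returnMap_mem_Icc_of_bound n m t ht).2⟩

theorem mapsTo_J (m : ℕ) :
    MapsTo (returnMap m) (Icc (ptA (m + 1)) (ptB (m + 1))) (Icc (ptC m) (ptD m)) := by
  intro t ht
  obtain ⟨l, r⟩ := mapsTo_returnMap (m + 1) ht
  have hr := ratio_pos m
  have hm := ratio_mul m
  rw [returnMap_on_J ht]
  constructor <;> nlinarith

/-- The affine map of `K (m + 1)` onto `J (m + 1)` inverts the rescaling built into `returnMap m` on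
`J (m + 1)`. -/
theorem returnMap_returnMap {m : ℕ} {t : ℝ} (ht : t ∈ Icc (ptA (m + 1)) (ptB (m + 1))) :
    returnMap m (returnMap m t) = returnMap (m + 1) t := by
  have h := slope_K_mul_ratio m
  rw [returnMap_on_K (mapsTo_J m ht), returnMap_on_J ht, add_sub_cancel_left, ← mul_assoc, h]
  ring

theorem surjOn_returnMap (m : ℕ) :
    SurjOn (returnMap m) (Icc (ptA m) (ptB m)) (Icc (ptA m) (ptB m)) := by
  have h := intermediate_value_Icc (ptA_lt_ptB m).le (continuous_returnMap m).continuousOn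
  rwa [returnMap_of_le le_rfl, returnMap_of_ge le_rfl] at h

theorem surjOn_J (m : ℕ) :
    SurjOn (returnMap m) (Icc (ptA (m + 1)) (ptB (m + 1))) (Icc (ptC m) (ptD m)) := by
  have h := intermediate_value_Icc (ptA_lt_ptB (m + 1)).le (continuous_returnMap m).continuousOn
  rw [returnMap_on_J (left_mem_Icc.2 (ptA_lt_ptB _).le), returnMap_of_le le_rfl,
    returnMap_on_J (right_mem_Icc.2 (ptA_lt_ptB _).le), returnMap_of_ge le_rfl, ratio_mul,
    sub_self, mul_zero, add_zero, add_sub_cancel] at h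
  exact h

theorem iterate_returnMap_two_mul {m : ℕ} (j : ℕ) : ∀ t ∈ Icc (ptA (m + 1)) (ptB (m + 1)),
    (returnMap m)^[2 * j] t = (returnMap (m + 1))^[j] t := by
  induction j with
  | zero => simp
  | succ j ih =>
    intro t ht
    rw [Nat.mul_succ, Function.iterate_add_apply, Function.iterate_succ_apply _ j,
      ← ih _ (mapsTo_returnMap _ ht)]
    exact congrArg _ (returnMap_returnMap ht)

end ChuXiongExample

/-! ### Growth of the variation of iterates of the example. -/

theorem eVariationOn_Icc_add_Icc {E : Type*} [PseudoEMetricSpace E] (f : ℝ → E) {a b c : ℝ}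
    (hab : a ≤ b) (hbc : b ≤ c) :
    eVariationOn f (Icc a c) = eVariationOn f (Icc a b) + eVariationOn f (Icc b c) := by
  simpa using (eVariationOn.Icc_add_Icc f (s := univ) hab hbc (mem_univ b)).symm

theorem eVariationOn_iterate_succ_le_of_monotoneOn {g : ℝ → ℝ} {s t : Set ℝ}
    (hg : MonotoneOn g s) (h : MapsTo g s t) (n : ℕ) :
    eVariationOn g^[n + 1] s ≤ eVariationOn g^[n] t :=
  eVariationOn.comp_le_of_monotoneOn g^[n] g hg h

theorem eVariationOn_iterate_succ_le_of_antitoneOn {g : ℝ → ℝ} {s t : Set ℝ}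
    (hg : AntitoneOn g s) (h : MapsTo g s t) (n : ℕ) :
    eVariationOn g^[n + 1] s ≤ eVariationOn g^[n] t :=
  eVariationOn.comp_le_of_antitoneOn g^[n] g hg h

theorem LipschitzWith.eVariationOn_comp_le {g h : ℝ → ℝ} {L : ℝ≥0} (hg : LipschitzWith L g)
    (s : Set ℝ) : eVariationOn (g ∘ h) s ≤ L * eVariationOn h s :=
  hg.lipschitzOnWith.comp_eVariationOn_le (mapsTo_univ h s)

theorem eVariationOn_iterate_zero_ne_top (g : ℝ → ℝ) (a b : ℝ) :
    eVariationOn g^[0] (Icc a b) ≠ ∞ := by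
  rw [Function.iterate_zero, eVariationOn_id_Icc]
  exact ENNReal.ofReal_ne_top

theorem LipschitzWith.expBounded_eVariationOn {g : ℝ → ℝ} {L : ℝ≥0} (hg : LipschitzWith L g)
    (a b : ℝ) : ExpBounded L fun n => eVariationOn g^[n] (Icc a b) := by
  refine ⟨(b - a).toNNReal, fun n => ?_⟩
  induction n with
  | zero => simp [ENNReal.ofReal]
  | succ n ih =>
    beta_reduce at ih ⊢
    rw [Function.iterate_succ']
    refine (hg.eVariationOn_comp_le _).trans ?_
    calc (L : ℝ≥0∞) * eVariationOn g^[n] (Icc a b)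
        ≤ L * ((b - a).toNNReal * (L : ℝ≥0∞) ^ n) := by gcongr
      _ = _ := by rw [pow_succ]; ring

theorem ExpBounded.mono_rate {r r' : ℝ≥0} {u : ℕ → ℝ≥0∞} (h : ExpBounded r u) (hr : r ≤ r') :
    ExpBounded r' u := by
  obtain ⟨C, hC⟩ := h
  exact ⟨C, fun n => (hC n).trans (by gcongr)⟩

namespace ChuXiongExample

/-- Even iterates are iterates of the next return map, at half the time; an odd one costs one
further Lipschitz factor. -/
theorem expBounded_eVariationOn_J {m : ℕ} {r : ℝ≥0} (hr : 1 < r)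
    (h : ExpBounded (r ^ 2) fun n => eVariationOn (returnMap (m + 1))^[n]
      (Icc (ptA (m + 1)) (ptB (m + 1)))) :
    ExpBounded r fun n => eVariationOn (returnMap m)^[n] (Icc (ptA (m + 1)) (ptB (m + 1))) := by
  obtain ⟨C, hC⟩ := h
  have heven : ∀ j, eVariationOn (returnMap m)^[2 * j] (Icc (ptA (m + 1)) (ptB (m + 1))) ≤
      C * (r : ℝ≥0∞) ^ (2 * j) := by
    intro j
    rw [eVariationOn.congr (iterate_returnMap_two_mul j), pow_mul]
    simpa using hC j
  refine ⟨101 * 2 ^ m * C, fun n => ?_⟩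
  have hL : (1 : ℝ≥0) ≤ 101 * 2 ^ m :=
    one_le_mul_of_one_le_of_one_le (by norm_num) (one_le_pow₀ (by norm_num))
  have hL' : (1 : ℝ≥0∞) ≤ ((101 * 2 ^ m : ℝ≥0) : ℝ≥0∞) := by exact_mod_cast hL
  rw [ENNReal.coe_mul, mul_assoc]
  obtain ⟨j, rfl | rfl⟩ := n.even_or_odd'
  · exact (heven j).trans (le_mul_of_one_le_left' hL')
  · beta_reduce
    rw [Function.iterate_succ']
    refine ((lipschitzWith_returnMap m).eVariationOn_comp_le _).trans ?_
    gcongr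
    refine (heven j).trans ?_
    gcongr
    · exact_mod_cast hr.le
    · omega

/-- The covering relations are triangular in the order `J`, `K`, `B`, `C`, `A`: each piece after `J`
maps monotonically over itself at most once and otherwise over earlier pieces, so
`ExpBounded.of_succ_le` applies in turn. -/
theorem expBounded_eVariationOn_of_succ {m : ℕ} {r : ℝ≥0} (hr : 1 < r)
    (h : ExpBounded (r ^ 2) fun n => eVariationOn (returnMap (m + 1))^[n]
      (Icc (ptA (m + 1)) (ptB (m + 1)))) :
    ExpBounded r fun n => eVariationOn (returnMap m)^[n] (Icc (ptA m) (ptB m)) := by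
  have h1 := (ptA_lt m).le
  have h2 := (ptA_lt_ptB (m + 1)).le
  have h3 := (ptB_lt_ptC m).le
  have h4 := (ptC_lt_ptD m).le
  have h5 := (ptD_lt_ptB m).le
  have hJ := expBounded_eVariationOn_J hr h
  have monoA : MonotoneOn (returnMap m) (Icc (ptA m) (ptA (m + 1))) := by
    intro s hs t ht hst
    rw [returnMap_on_A hs, returnMap_on_A ht]
    have := slope_A_pos m
    gcongr
  have antiB : AntitoneOn (returnMap m) (Icc (ptB (m + 1)) (ptC m)) := by
    intro s hs t ht hst
    rw [returnMap_on_B hs, returnMap_on_B ht]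
    have := slope_B_pos m
    gcongr
  have monoK : MonotoneOn (returnMap m) (Icc (ptC m) (ptD m)) := by
    intro s hs t ht hst
    rw [returnMap_on_K hs, returnMap_on_K ht]
    have := slope_K_pos m
    gcongr
  have monoC : MonotoneOn (returnMap m) (Icc (ptD m) (ptB m)) := by
    intro s hs t ht hst
    rw [returnMap_on_C hs, returnMap_on_C ht]
    gcongr
  have hK : ExpBounded r fun n => eVariationOn (returnMap m)^[n] (Icc (ptC m) (ptD m)) :=
    hJ.of_succ_le hr (eVariationOn_iterate_zero_ne_top _ _ _) fun n =>
      (eVariationOn_iterate_succ_le_of_monotoneOn monoK (mapsTo_K m) n).trans le_add_self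
  have hB : ExpBounded r fun n => eVariationOn (returnMap m)^[n] (Icc (ptB (m + 1)) (ptC m)) := by
    refine (hJ.add hK).of_succ_le hr (eVariationOn_iterate_zero_ne_top _ _ _) fun n => ?_
    refine (eVariationOn_iterate_succ_le_of_antitoneOn antiB (mapsTo_B m) n).trans_eq ?_
    rw [eVariationOn_Icc_add_Icc _ h2 (h3.trans h4), eVariationOn_Icc_add_Icc _ h3 h4]
    ring
  have hC : ExpBounded r fun n => eVariationOn (returnMap m)^[n] (Icc (ptD m) (ptB m)) := by
    refine (hB.add hK).of_succ_le hr (eVariationOn_iterate_zero_ne_top _ _ _) fun n => ?_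
    refine (eVariationOn_iterate_succ_le_of_monotoneOn monoC (mapsTo_C m) n).trans_eq ?_
    rw [eVariationOn_Icc_add_Icc _ h3 (h4.trans h5), eVariationOn_Icc_add_Icc _ h4 h5]
    ring
  have hA : ExpBounded r fun n => eVariationOn (returnMap m)^[n] (Icc (ptA m) (ptA (m + 1))) := by
    refine (hJ.add hB).of_succ_le hr (eVariationOn_iterate_zero_ne_top _ _ _) fun n => ?_
    refine (eVariationOn_iterate_succ_le_of_monotoneOn monoA (mapsTo_A m) n).trans_eq ?_
    rw [eVariationOn_Icc_add_Icc _ h1 (h2.trans h3), eVariationOn_Icc_add_Icc _ h2 h3]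
  refine (hA.add (hJ.add (hB.add (hK.add hC)))).mono fun n => le_of_eq ?_
  rw [eVariationOn_Icc_add_Icc _ h1 (h2.trans (h3.trans (h4.trans h5))),
    eVariationOn_Icc_add_Icc _ h2 (h3.trans (h4.trans h5)),
    eVariationOn_Icc_add_Icc _ h3 (h4.trans h5), eVariationOn_Icc_add_Icc _ h4 h5]

theorem expBounded_eVariationOn_zero (k : ℕ) : ∀ r : ℝ≥0, 1 < r →
    (ExpBounded (r ^ 2 ^ k) fun n => eVariationOn (returnMap k)^[n] (Icc (ptA k) (ptB k))) →
    ExpBounded r fun n => eVariationOn (returnMap 0)^[n] (Icc (ptA 0) (ptB 0)) := by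
  induction k with
  | zero => intro r _ h; simpa using h
  | succ k ih =>
    intro r hr h
    refine ih r hr (expBounded_eVariationOn_of_succ (one_lt_pow₀ hr (by positivity)) ?_)
    rwa [← pow_mul, ← pow_succ]

theorem exists_lipschitz_const_le {r : ℝ≥0} (hr : 1 < r) : ∃ k : ℕ, 101 * 2 ^ k ≤ r ^ 2 ^ k := by
  -- With `N = 2 ^ k` the claim reads `101 * N ≤ r ^ N`, true for large `N`.
  have hr' : (1 : ℝ) < r := hr
  have h := (tendsto_pow_const_div_const_pow_of_one_lt 1 hr').comp
    (tendsto_pow_atTop_atTop_of_one_lt (one_lt_two : (1 : ℕ) < 2))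
  obtain ⟨k, hk⟩ := (h.eventually (eventually_lt_nhds (show (0 : ℝ) < 1 / 101 by norm_num))).exists
  refine ⟨k, ?_⟩
  simp only [Function.comp_apply, pow_one] at hk
  rw [div_lt_div_iff₀ (by positivity) (by norm_num)] at hk
  rw [← NNReal.coe_le_coe]
  push_cast at hk ⊢
  linarith

theorem expBounded_eVariationOn {r : ℝ≥0} (hr : 1 < r) :
    ExpBounded r fun n => eVariationOn (returnMap 0)^[n] (Icc (ptA 0) (ptB 0)) := by
  obtain ⟨k, hk⟩ := exists_lipschitz_const_le hr
  exact expBounded_eVariationOn_zero k r hr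
    (((lipschitzWith_returnMap k).expBounded_eVariationOn _ _).mono_rate hk)

end ChuXiongExample

/-! ### The example satisfies the Chu–Xiong conditions. -/

theorem isIncreasingLinearBij_of_slope {g : unitInterval → unitInterval} {u v u' v' : unitInterval}
    {m : ℝ} (hm : 0 < m) (hv : m * ((v : ℝ) - u) = v' - u')
    (hg : ∀ t ∈ Icc u v, (g t : ℝ) = u' + m * ((t : ℝ) - u)) :
    IsIncreasingLinearBij g (Icc u v) (Icc u' v') := by
  refine ⟨⟨fun t ht => ?_, fun s hs t ht hst => ?_, fun z hz => ?_⟩, m, u' - m * u, hm,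
    fun t ht => by rw [hg t ht]; ring⟩
  · have h1 : (u : ℝ) ≤ t := ht.1
    have h2 : (t : ℝ) ≤ v := ht.2
    constructor
    · change (u' : ℝ) ≤ g t
      rw [hg t ht]; nlinarith
    · change (g t : ℝ) ≤ v'
      rw [hg t ht]; nlinarith
  · have h := congrArg (Subtype.val) hst
    rw [hg s hs, hg t ht] at h
    have h' := mul_left_cancel₀ hm.ne' (add_left_cancel h)
    exact Subtype.ext (sub_left_injective h')
  · have h1 : (u' : ℝ) ≤ z := hz.1
    have h2 : (z : ℝ) ≤ v' := hz.2
    have h3 : 0 ≤ ((z : ℝ) - u') / m := div_nonneg (by linarith) hm.le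
    have h4 : ((z : ℝ) - u') / m ≤ v - u := by
      rw [div_le_iff₀ hm, mul_comm, hv]; linarith
    have ht : (⟨u + ((z : ℝ) - u') / m, by linarith [u.2.1], by linarith [v.2.2]⟩ : unitInterval) ∈
        Icc u v := by
      constructor
      · change (u : ℝ) ≤ u + ((z : ℝ) - u') / m; linarith
      · change u + ((z : ℝ) - u') / m ≤ (v : ℝ); linarith
    refine ⟨_, ht, Subtype.ext ?_⟩
    rw [hg _ ht]
    field_simp
    ring

theorem isDecreasingLinearBij_of_slope {g : unitInterval → unitInterval} {u v u' v' : unitInterval}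
    {m : ℝ} (hm : 0 < m) (hv : m * ((v : ℝ) - u) = v' - u')
    (hg : ∀ t ∈ Icc u v, (g t : ℝ) = v' - m * ((t : ℝ) - u)) :
    IsDecreasingLinearBij g (Icc u v) (Icc u' v') := by
  -- Reflecting the target reduces the claim to the increasing case.
  have hσ : IsIncreasingLinearBij (unitInterval.symm ∘ g) (Icc u v)
      (Icc (unitInterval.symm v') (unitInterval.symm u')) := by
    refine isIncreasingLinearBij_of_slope hm ?_ fun t ht => ?_
    · rw [hv, unitInterval.coe_symm_eq, unitInterval.coe_symm_eq]; ring
    · rw [Function.comp_apply, unitInterval.coe_symm_eq, unitInterval.coe_symm_eq, hg t ht]; ring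
  refine ⟨⟨fun t ht => ?_, fun s hs t ht hst => ?_, fun z hz => ?_⟩, -m, v' + m * u, by linarith,
    fun t ht => by rw [hg t ht]; ring⟩
  · obtain ⟨h1, h2⟩ := hσ.1.mapsTo ht
    exact ⟨unitInterval.symm_le_symm.1 h2, unitInterval.symm_le_symm.1 h1⟩
  · exact hσ.1.injOn hs ht (congrArg unitInterval.symm hst)
  · obtain ⟨t, ht, e⟩ := hσ.1.surjOn (show unitInterval.symm z ∈ _ from
      ⟨unitInterval.symm_le_symm.2 hz.2, unitInterval.symm_le_symm.2 hz.1⟩)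
    exact ⟨t, ht, unitInterval.symm_bijective.injective e⟩

/-- A preconnected set that is separated by a gap from the rest of a set is one of its
leftmost components. -/
theorem isLeftmostComponent_of_gap {S : Set unitInterval} {u v w : unitInterval} (huv : u ≤ v)
    (hS : Icc u v ⊆ S) (hvw : v < w) (hgap : ∀ t ∈ S, t ∉ Icc u v → w ≤ t) :
    IsLeftmostComponent S (Icc u v) := by
  have hv : v ∈ Icc u v := right_mem_Icc.2 huv
  refine ⟨⟨v, hS hv, subset_antisymm ?_ fun t ht => ?_⟩, fun s hs t ht =>
    hs.2.trans_lt (hvw.trans_le (hgap t ht.1 ht.2))⟩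
  · exact isPreconnected_Icc.subset_connectedComponentIn hv hS
  · by_contra hnot
    have hwt := hgap t (connectedComponentIn_subset _ _ ht) hnot
    obtain ⟨r, hr1, hr2⟩ := exists_between hvw
    have hr := connectedComponentIn_subset _ _ (isPreconnected_connectedComponentIn.ordConnected.out
      (mem_connectedComponentIn (hS hv)) ht ⟨hr1.le, hr2.le.trans hwt⟩)
    exact absurd (hgap r hr fun h => absurd hr1 (not_lt.2 h.2)) (not_le.2 hr2)

namespace ChuXiongExample

theorem mem_unitInterval {n : ℕ} {t : ℝ} (h : t ∈ Icc (ptA n) (ptB n)) : t ∈ unitInterval :=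
  ⟨(ptA_nonneg n).trans h.1, h.2.trans (ptB_le_one n)⟩

theorem tendsto_scale : Tendsto scale atTop (𝓝 0) :=
  tendsto_pow_atTop_nhds_zero_of_lt_one (by norm_num) (by norm_num)

theorem ptA_zero : ptA 0 = 0 := by simp [ptA, scale]

theorem ptB_zero : ptB 0 = 1 := by norm_num [ptB, scale]

/-- The intervals of the example; the intersection of the `J n` is `[1/4, 1/2]`. -/
noncomputable def intervals : ChuXiongIntervals where
  a n := ⟨ptA n, mem_unitInterval (left_mem_Icc.2 (ptA_lt_ptB n).le)⟩
  b n := ⟨ptB n, mem_unitInterval (right_mem_Icc.2 (ptA_lt_ptB n).le)⟩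
  c n := ⟨ptC n, mem_unitInterval (n := n) ⟨by
    linarith [ptA_lt n, ptA_lt_ptB (n + 1), ptB_lt_ptC n], by
    linarith [ptC_lt_ptD n, ptD_lt_ptB n]⟩⟩
  d n := ⟨ptD n, mem_unitInterval (n := n) ⟨by
    linarith [ptA_lt n, ptA_lt_ptB (n + 1), ptB_lt_ptC n, ptC_lt_ptD n], (ptD_lt_ptB n).le⟩⟩
  x := ⟨1 / 4, by norm_num, by norm_num⟩
  y := ⟨1 / 2, by norm_num, by norm_num⟩
  a_zero := Subtype.ext ptA_zero
  b_zero := Subtype.ext ptB_zero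
  a_lt n := ptA_lt n
  a_lt_b n := ptA_lt_ptB (n + 1)
  b_lt_c n := ptB_lt_ptC n
  c_lt_d n := ptC_lt_ptD n
  d_lt_b n := ptD_lt_ptB n
  x_lt_y := by
    change (1 / 4 : ℝ) < 1 / 2
    norm_num
  iInter_eq := by
    ext t
    rw [mem_iInter]
    refine ⟨fun h => ⟨?_, ?_⟩, fun h n => ⟨?_, ?_⟩⟩
    · have hlim : Tendsto (fun n => (1 - scale n) / 4) atTop (𝓝 (1 / 4)) := by
        simpa using (tendsto_scale.const_sub 1).div_const 4
      change (1 / 4 : ℝ) ≤ t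
      exact le_of_tendsto' hlim fun n => (h n).1
    · have hlim : Tendsto (fun n => (1 + scale n) / 2) atTop (𝓝 (1 / 2)) := by
        simpa using (tendsto_scale.const_add 1).div_const 2
      change (t : ℝ) ≤ 1 / 2
      exact ge_of_tendsto' hlim fun n => (h n).2
    · have h1 : (1 / 4 : ℝ) ≤ t := h.1
      have := scale_pos n
      change (1 - scale n) / 4 ≤ (t : ℝ)
      linarith
    · have h1 : (t : ℝ) ≤ 1 / 2 := h.2
      have := scale_pos n
      change (t : ℝ) ≤ (1 + scale n) / 2
      linarith

theorem returnMap_zero_mem (t : unitInterval) : returnMap 0 t ∈ unitInterval := by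
  have h := mapsTo_returnMap 0
  rw [ptA_zero, ptB_zero] at h
  exact h t.2

/-- A Chu–Xiong map. -/
noncomputable def map (t : unitInterval) : unitInterval := ⟨returnMap 0 t, returnMap_zero_mem t⟩

theorem continuous_map : Continuous map :=
  ((continuous_returnMap 0).comp continuous_subtype_val).subtype_mk _

theorem coe_iterate_map (n : ℕ) (t : unitInterval) :
    ((map^[n] t : unitInterval) : ℝ) = (returnMap 0)^[n] t := by
  induction n with
  | zero => rfl
  | succ n ih => rw [Function.iterate_succ_apply', Function.iterate_succ_apply', ← ih]; rfl

theorem coverEntropy_map : Dynamics.coverEntropy map univ = 0 := by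
  refine coverEntropy_eq_zero_of_expBounded map fun r hr => (expBounded_eVariationOn hr).mono
    fun n => ?_
  have h1 : eVariationOn map^[n] univ =
      eVariationOn ((returnMap 0)^[n] ∘ ((↑) : unitInterval → ℝ)) univ := by
    have : (returnMap 0)^[n] ∘ ((↑) : unitInterval → ℝ) = fun t => ((map^[n] t : unitInterval) : ℝ) :=
      funext fun t => (coe_iterate_map n t).symm
    rw [this]
    rfl
  rw [h1, ptA_zero, ptB_zero]
  exact eVariationOn.comp_le_of_monotoneOn _ _ (fun _ _ _ _ h => h) fun t _ => t.2

theorem Icc_succ_subset (m : ℕ) :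
    Icc (ptA (m + 1)) (ptB (m + 1)) ⊆ Icc (ptA m) (ptB m) :=
  Icc_subset_Icc (ptA_lt m).le (ptB_antitone m.le_succ)

theorem Icc_ptC_ptD_subset (m : ℕ) : Icc (ptC m) (ptD m) ⊆ Icc (ptA m) (ptB m) :=
  Icc_subset_Icc ((ptA_lt m).trans ((ptA_lt_ptB (m + 1)).trans (ptB_lt_ptC m))).le (ptD_lt_ptB m).le

/-- On `J m`, the iterate of order `2 ^ m` is the return map. -/
theorem coe_iterate_two_pow (m : ℕ) : ∀ t ∈ intervals.J m,
    ((map^[2 ^ m] t : unitInterval) : ℝ) = returnMap m t := by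
  induction m with
  | zero => intro t _; rfl
  | succ m ih =>
    intro t ht
    have ht' : t ∈ intervals.J m := Icc_succ_subset m ht
    have h1 := ih t ht'
    have hmem : map^[2 ^ m] t ∈ intervals.J m := by
      have : ((map^[2 ^ m] t : unitInterval) : ℝ) ∈ Icc (ptA m) (ptB m) := by
        rw [h1]; exact mapsTo_returnMap m ht'
      exact this
    rw [pow_succ, mul_two, Function.iterate_add_apply, ih _ hmem, h1, returnMap_returnMap ht]

theorem image_J (m : ℕ) : map^[2 ^ m] '' intervals.J m = intervals.J m := by
  refine subset_antisymm (image_subset_iff.2 fun t ht => ?_) fun z hz => ?_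
  · have : ((map^[2 ^ m] t : unitInterval) : ℝ) ∈ Icc (ptA m) (ptB m) := by
      rw [coe_iterate_two_pow m t ht]; exact mapsTo_returnMap m ht
    exact this
  · obtain ⟨t, ht, e⟩ := surjOn_returnMap m (show (z : ℝ) ∈ Icc (ptA m) (ptB m) from hz)
    exact ⟨⟨t, mem_unitInterval ht⟩, ht, Subtype.ext ((coe_iterate_two_pow m _ ht).trans e)⟩

theorem image_J_succ (m : ℕ) : map^[2 ^ m] '' intervals.J (m + 1) = intervals.Ksucc m := by
  refine subset_antisymm (image_subset_iff.2 fun t ht => ?_) fun z hz => ?_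
  · have : ((map^[2 ^ m] t : unitInterval) : ℝ) ∈ Icc (ptC m) (ptD m) := by
      rw [coe_iterate_two_pow m t (Icc_succ_subset m ht)]; exact mapsTo_J m ht
    exact this
  · obtain ⟨t, ht, e⟩ := surjOn_J m (show (z : ℝ) ∈ Icc (ptC m) (ptD m) from hz)
    exact ⟨⟨t, mem_unitInterval ht⟩, ht,
      Subtype.ext ((coe_iterate_two_pow m _ (Icc_succ_subset m ht)).trans e)⟩

theorem mapsTo_Ksucc (m : ℕ) : MapsTo map^[2 ^ m] (intervals.Ksucc m) (intervals.J (m + 1)) := by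
  intro t ht
  have : ((map^[2 ^ m] t : unitInterval) : ℝ) ∈ Icc (ptA (m + 1)) (ptB (m + 1)) := by
    rw [coe_iterate_two_pow m t (Icc_ptC_ptD_subset m ht)]; exact mapsTo_K m ht
  exact this

theorem J_succ_subset (m : ℕ) : intervals.J (m + 1) ⊆ intervals.J m := fun _ ht =>
  Icc_succ_subset m ht

theorem disjoint_J_Ksucc (m : ℕ) : Disjoint (intervals.J (m + 1)) (intervals.Ksucc m) :=
  disjoint_left.2 fun _ h1 h2 => absurd (h2.1.trans h1.2) (not_le.2 (intervals.b_lt_c m))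

/-- Indices distinct modulo `2 ^ m` are separated already by the images of `J m`. Otherwise they are
`j` and `2 ^ m + j`; a common point, pushed forward `2 ^ m - j` steps, would lie in both `K (m + 1)`
and `J (m + 1)`. -/
theorem disjoint_image_J (m : ℕ) : ∀ i < 2 ^ m, ∀ j < 2 ^ m, i ≠ j →
    Disjoint (map^[i] '' intervals.J m) (map^[j] '' intervals.J m) := by
  induction m with
  | zero => intro i hi j hj hij; simp at hi hj; omega
  | succ m ih =>
    have hlt : ∀ j < 2 ^ m,
        Disjoint (map^[2 ^ m + j] '' intervals.J (m + 1)) (map^[j] '' intervals.J (m + 1)) := by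
      intro j hj
      rw [disjoint_left]
      rintro _ ⟨p, hp, rfl⟩ ⟨q, hq, e⟩
      rw [add_comm, Function.iterate_add_apply] at e
      have hpK : map^[2 ^ m] p ∈ intervals.Ksucc m := image_J_succ m ▸ mem_image_of_mem _ hp
      have hqK : map^[2 ^ m] q ∈ intervals.Ksucc m := image_J_succ m ▸ mem_image_of_mem _ hq
      have e' := congrArg map^[2 ^ m - j] e
      rw [← Function.iterate_add_apply, ← Function.iterate_add_apply,
        Nat.sub_add_cancel hj.le] at e'
      exact disjoint_left.1 (disjoint_J_Ksucc m) (mapsTo_Ksucc m hpK) (e' ▸ hqK)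
    intro i hi j hj hij
    rw [pow_succ] at hi hj
    by_cases hmod : i % 2 ^ m = j % 2 ^ m
    · rcases lt_or_ge i (2 ^ m) with h1 | h1 <;> rcases lt_or_ge j (2 ^ m) with h2 | h2
      · rw [Nat.mod_eq_of_lt h1, Nat.mod_eq_of_lt h2] at hmod
        exact absurd hmod hij
      · rw [Nat.mod_eq_of_lt h1, Nat.mod_eq_sub_mod h2, Nat.mod_eq_of_lt (by omega)] at hmod
        obtain rfl : j = 2 ^ m + i := by omega
        exact (hlt i h1).symm
      · rw [Nat.mod_eq_of_lt h2, Nat.mod_eq_sub_mod h1, Nat.mod_eq_of_lt (by omega)] at hmod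
        obtain rfl : i = 2 ^ m + j := by omega
        exact hlt j h2
      · rw [Nat.mod_eq_sub_mod h1, Nat.mod_eq_sub_mod h2, Nat.mod_eq_of_lt (by omega),
          Nat.mod_eq_of_lt (by omega)] at hmod
        omega
    · have h := ih _ (Nat.mod_lt i (by positivity)) _ (Nat.mod_lt j (by positivity)) hmod
      rw [← image_iterate_mod (image_J m) i, ← image_iterate_mod (image_J m) j] at h
      exact h.mono (image_mono (J_succ_subset m)) (image_mono (J_succ_subset m))

/-- The intervals of the cycle of `J m` other than `J m` stay away from it, on its right. -/
theorem gap_le_iterate (m : ℕ) : ∀ i, ¬ 2 ^ m ∣ i → ∀ t ∈ intervals.J m,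
    ptB m + scale m / 4 ≤ ((map^[i] t : unitInterval) : ℝ) := by
  induction m with
  | zero => intro i hi; simp at hi
  | succ m ih =>
    intro i hi t ht
    have hs := scale_pos m
    by_cases hd : 2 ^ m ∣ i
    · obtain ⟨j, rfl⟩ := hd
      -- An odd multiple of `2 ^ m` sends `J (m + 1)` into `K (m + 1)`, whose left end is exactly
      -- `ptB (m + 1) + scale (m + 1) / 4`.
      have hodd : j % 2 = 1 := by
        by_contra hj
        exact hi (by rw [pow_succ]; exact mul_dvd_mul_left _ (by omega))
      have hmem : map^[2 ^ m * j] t ∈ intervals.Ksucc m := by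
        have hj : 2 ^ m * j = 2 ^ m + 2 ^ (m + 1) * (j / 2) := by
          conv_lhs => rw [← Nat.mod_add_div j 2, hodd]
          ring
        rw [← image_J_succ m, hj, Function.iterate_add_apply]
        refine mem_image_of_mem _ ?_
        have := mem_image_of_mem map^[2 ^ (m + 1) * (j / 2)] ht
        rwa [image_iterate_mod (image_J (m + 1)), Nat.mul_mod_right, Function.iterate_zero,
          image_id] at this
      have h1 : ptC m ≤ ((map^[2 ^ m * j] t : unitInterval) : ℝ) := hmem.1
      refine le_trans ?_ h1
      unfold ptB ptC
      rw [scale_succ]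
      linarith
    · refine le_trans ?_ (ih i hd t (J_succ_subset m ht))
      unfold ptB
      rw [scale_succ]
      linarith

theorem isLeftmostComponent_J (m : ℕ) :
    IsLeftmostComponent (setOrbit map (intervals.J m)) (intervals.J m) := by
  cases m with
  -- Level `0` is separate: its gap point would be `5 / 4`, outside the unit interval.
  | zero =>
    have hJ : intervals.J 0 = univ := by
      ext t
      simp only [mem_univ, iff_true]
      exact ⟨intervals.a_zero ▸ t.2.1, intervals.b_zero ▸ t.2.2⟩
    have hS : setOrbit map (intervals.J 0) = univ :=
      univ_subset_iff.1 (hJ.symm.subset.trans (subset_setOrbit _ _))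
    rw [hS, hJ]
    refine ⟨⟨0, mem_univ _, ?_⟩, fun u _ v hv => absurd (mem_univ v) hv.2⟩
    rw [connectedComponentIn_univ, PreconnectedSpace.connectedComponent_eq_univ]
  | succ m =>
    have hs := scale_pos m
    refine isLeftmostComponent_of_gap (w := ⟨ptB (m + 1) + scale (m + 1) / 4, ?_, ?_⟩)
      (intervals.a_lt_b m).le (subset_setOrbit _ _) ?_ ?_
    · have := ptA_nonneg (m + 1)
      have := ptA_lt_ptB (m + 1)
      rw [scale_succ]
      linarith
    · have := scale_le_one m
      unfold ptB
      rw [scale_succ]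
      linarith
    · change ptB (m + 1) < ptB (m + 1) + scale (m + 1) / 4
      linarith [scale_pos (m + 1)]
    · intro t ht hnot
      obtain ⟨i, s, hs, rfl⟩ := mem_iUnion.1 ht
      refine gap_le_iterate (m + 1) i (fun hd => hnot ?_) s hs
      have := mem_image_of_mem map^[i] hs
      rwa [image_iterate_mod (image_J (m + 1)), Nat.mod_eq_zero_of_dvd hd, Function.iterate_zero,
        image_id] at this

theorem isChuXiongMap_map : IsChuXiongMap intervals map where
  continuous := continuous_map
  orbit_zero := by
    refine univ_subset_iff.1 fun t _ => subset_setOrbit _ _ ?_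
    exact ⟨intervals.a_zero ▸ t.2.1, intervals.b_zero ▸ t.2.2⟩
  orbit_succ_subset m := setOrbit_mono (J_succ_subset m)
  periodic m := ⟨by positivity, ⟨_, _, ptA_lt_ptB m, rfl⟩, disjoint_image_J m, image_J m⟩
  leftmost := isLeftmostComponent_J
  on_A m := by
    rw [intervals.A_union]
    refine isIncreasingLinearBij_of_slope (slope_A_pos m) (slope_A_mul m) fun t ht => ?_
    rw [coe_iterate_two_pow m t ⟨ht.1, ht.2.trans ((intervals.a_lt_b m).trans
      (intervals.b_strictAnti m.lt_succ_self)).le⟩]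
    exact returnMap_on_A ht
  on_J := image_J_succ
  on_B m := by
    have e : intervals.Ksucc m ∪ intervals.B m ∪ intervals.J (m + 1) =
        Icc (intervals.a (m + 1)) (intervals.d m) := by
      rw [union_comm, union_comm (intervals.Ksucc m), ← union_assoc]
      exact (congrArg (· ∪ _) (Icc_union_Icc_eq_Icc (intervals.a_lt_b m).le
        (intervals.b_lt_c m).le)).trans (Icc_union_Icc_eq_Icc
          ((intervals.a_lt_b m).trans (intervals.b_lt_c m)).le (intervals.c_lt_d m).le)
    rw [e]
    refine isDecreasingLinearBij_of_slope (slope_B_pos m) (slope_B_mul m) fun t ht => ?_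
    rw [coe_iterate_two_pow m t ⟨((intervals.a_lt m).trans (intervals.a_lt_b m)).le.trans ht.1,
      ht.2.trans ((intervals.c_lt_d m).trans (intervals.d_lt_b m)).le⟩]
    exact returnMap_on_B ht
  on_K m := by
    refine isIncreasingLinearBij_of_slope (slope_K_pos m) (slope_K_mul m) fun t ht => ?_
    rw [coe_iterate_two_pow m t (Icc_ptC_ptD_subset m ht)]
    exact returnMap_on_K ht
  on_C m := by
    have e : intervals.B m ∪ intervals.Ksucc m ∪ intervals.C m =
        Icc (intervals.b (m + 1)) (intervals.b m) :=
      (congrArg (· ∪ _) (Icc_union_Icc_eq_Icc (intervals.b_lt_c m).le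
        (intervals.c_lt_d m).le)).trans (Icc_union_Icc_eq_Icc
          ((intervals.b_lt_c m).trans (intervals.c_lt_d m)).le (intervals.d_lt_b m).le)
    rw [e]
    refine isIncreasingLinearBij_of_slope (by norm_num) (slope_C_mul m) fun t ht => ?_
    rw [coe_iterate_two_pow m t ⟨((intervals.a_lt m).trans ((intervals.a_lt_b m).trans
      ((intervals.b_lt_c m).trans (intervals.c_lt_d m)))).le.trans ht.1, ht.2⟩]
    exact returnMap_on_C ht

end ChuXiongExample

theorem mainTheorem3 :
    -- the Chu–Xiong map exists and has zero topological entropy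
    (∃ (S : ChuXiongIntervals) (f : unitInterval → unitInterval),
      IsChuXiongMap S f ∧ Dynamics.coverEntropy f univ = 0) ∧
    -- for every map as constructed by Chu and Xiong, with `x` the left endpoint of `⋂ n, J n`
    (∀ (S : ChuXiongIntervals) (f : unitInterval → unitInterval), IsChuXiongMap S f →
      S.x ∈ closure (specialAlphaLimit f S.x) ∧ S.x ∉ specialAlphaLimit f S.x ∧
        ¬ IsClosed (specialAlphaLimit f S.x)) ∧
    -- the Kolyada–Misiurewicz–Snoha conjecture is false
    ¬ (∀ f : unitInterval → unitInterval, Continuous f →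
      ∀ z : unitInterval, IsClosed (specialAlphaLimit f z)) := by
  refine ⟨⟨_, _, ChuXiongExample.isChuXiongMap_map, ChuXiongExample.coverEntropy_map⟩,
    fun S f h => ⟨h.x_mem_closure, h.x_notMem_specialAlphaLimit, h.not_isClosed_specialAlphaLimit⟩,
    fun h => ?_⟩
  exact ChuXiongExample.isChuXiongMap_map.not_isClosed_specialAlphaLimit
    (h _ ChuXiongExample.continuous_map _)
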